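/- Let $d\geq 1$ be an odd integer and let $\|\cdot\|$ be the Euclidean norm on $\mathbb{R}^d$. For $s>0$ and $z\in\mathbb{R}^d$ let $\mathbb{B}^d_s(z)=\{x\in\mathbb{R}^d:\|x-z\|\leq s\}$ and $\mathbb{B}^d_s=\mathbb{B}^d_s(0)$, and let $\delta_x$ be the point measure at $x$. For $r>0$ put $$K_{d,r}(x,y)=\frac{1}{\mathrm{vol}(\mathbb{B}^d_{r/2})}\int_{\mathbb{R}^d}\delta_x(\mathbb{B}^d_{r/2}(z))\,\delta_y(\mathbb{B}^d_{r/2}(z))\,\mathrm{d}z,\qquad x,y\in\mathbb{R}^d.$$ Let $G_d:[0,\infty)\to\mathbb{R}$ be given by $$G_d(r)=\sum_{n=0}^\infty\frac{(-\frac{d+1}{4})_n(-\frac{d-1}{4})_n}{(-\frac d2)_n}\frac{r^{2n}}{n!}={}_2F_1\Big(-\tfrac{d+1}{4},-\tfrac{d-1}{4};-\tfrac d2;r^2\Big)\quad(0\leq r\leq 1),\qquad G_d(r)=0\quad(r>1),$$ where $(f)_n=f(f+1)\cdots(f+n-1)$ and $(f)_0=1$; as $d$ is odd, the series terminates. Then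 $G_d$ is of bounded variation, and for all $x,y\in\mathbb{R}^d$ the function $r\mapsto K_{d,r}(x,y)$ is integrable on $(0,\infty)$ with respect to the Lebesgue--Stieltjes measure $\mathrm{d}G_d$ (which has the atom $-G_d(1)$ at $r=1$), and the kernel $$K_d(x,y):=-\int_0^\infty K_{d,r}(x,y)\,\mathrm{d}G_d(r)$$ satisfies $$K_d(x,y)=(1-\|x-y\|)_+^{\frac{d+1}{2}},\qquad x,y\in\mathbb{R}^d,$$ where $t_+=\max(t,0)$. -/

import Mathlib

open MeasureTheory Set

noncomputable section

namespace AskeyKernel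

/-- The kernel `K_{d,r}(x, y) = vol(B_{r/2})⁻¹ ∫ δ_x(B_{r/2}(z)) δ_y(B_{r/2}(z)) dz`
of the discrepancy of closed Euclidean balls of radius `r / 2` in `ℝ^d`. -/
def ballKernel (d : ℕ) (r : ℝ) (x y : EuclideanSpace ℝ (Fin d)) : ℝ :=
  (volume.real (Metric.closedBall (0 : EuclideanSpace ℝ (Fin d)) (r / 2)))⁻¹ *
    ∫ z : EuclideanSpace ℝ (Fin d),
      (Measure.dirac x).real (Metric.closedBall z (r / 2)) *
        (Measure.dirac y).real (Metric.closedBall z (r / 2))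

/-- The function `G_d(r) = ₂F₁(-(d+1)/4, -(d-1)/4; -d/2; r²)` for `0 ≤ r ≤ 1` and `G_d(r) = 0` for
`r > 1`. It is extended to `r < 0` by the constant `G_d(0)`, so that `dG_d` does not charge
`(-∞, 0]`. -/
def G (d : ℕ) (r : ℝ) : ℝ :=
  if r ≤ 1 then
    ₂F₁ (-((d : ℝ) + 1) / 4) (-((d : ℝ) - 1) / 4) (-(d : ℝ) / 2) ((max r 0) ^ 2)
  else 0

open Classical in
/-- The Lebesgue--Stieltjes signed measure `dF` of a function `F` of bounded variation on `ℝ`, with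
`dF((a, b]) = F(b+) - F(a+)`; the zero measure if `F` is not of bounded variation. -/
def stieltjesMeasure (F : ℝ → ℝ) : SignedMeasure ℝ :=
  if h : BoundedVariationOn F univ then h.vectorMeasure else 0

/-- The kernel `K_d(x, y) = - ∫_0^∞ K_{d,r}(x, y) dG_d(r)`. The weight `G_d` goes down from
`G_d(0) = 1` to `0`, so `-dG_d` is the measure of total mass one that has `G_d` as its tail. -/
def kernel (d : ℕ) (x y : EuclideanSpace ℝ (Fin d)) : ℝ :=
  -∫ᵛ r in Ioi (0 : ℝ), ballKernel d r x y ∂•(stieltjesMeasure (G d))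

end AskeyKernel

end

/-!
Two balls of radius `r / 2` whose centres have distance `t` meet in two caps of the same size, so
`ballKernel d r x y` is `Φ (t / r) / Φ 0` with `Φ u = ∫ s in u..1, (1 - s ^ 2) ^ ((d - 1) / 2)`.
Hence, for a smooth weight `w` cut off at `1`, exchanging the integrals over `r` and `s` turns the
Stieltjes integral into `∫ s in t..1, w (t / s) * (1 - s ^ 2) ^ ((d - 1) / 2)`, up to the factor
`Φ 0`.

Let `d = 2 * m + 1` and `w r = P (r ^ 2)` with `P.natDegree ≤ m`. The latter integral is then a
polynomial in `t` of degree at most `2 * m + 1` that vanishes to order `m + 1` at `t = 1`. Such a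
polynomial is determined by its even coefficients: a difference of two with the same even part is
odd, hence divisible by both `(X - 1) ^ (m + 1)` and `(X + 1) ^ (m + 1)`. The even coefficients are
those of `P` times the moments of `(1 - s ^ 2) ^ m`, and the hypergeometric coefficients are the
ones that make them proportional to those of `(1 - X) ^ (m + 1)`.
-/

noncomputable section

namespace AskeyKernel

section Polynomial

open Polynomial Filter Asymptotics Topology

theorem X_sub_C_pow_dvd_of_isBigO {𝕜 : Type*} [NormedField 𝕜] {P : 𝕜[X]} {a : 𝕜} {N : ℕ}
    {l : Filter 𝕜} [l.NeBot] (hl : l ≤ 𝓝[≠] a)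
    (hP : (fun t => P.eval t) =O[l] fun t => (t - a) ^ N) : (X - C a) ^ N ∣ P := by
  rcases eq_or_ne P 0 with rfl | hP0
  · exact dvd_zero _
  obtain ⟨Q, hPQ, hQ⟩ := exists_eq_pow_rootMultiplicity_mul_and_not_dvd P hP0 a
  have hle : N ≤ P.rootMultiplicity a := by
    by_contra! hlt
    set n := P.rootMultiplicity a
    obtain ⟨k, rfl⟩ := Nat.exists_eq_add_of_lt hlt
    have hne : ∀ᶠ t in l, t - a ≠ 0 :=
      (eventually_mem_nhdsWithin.filter_mono hl).mono fun t ht => sub_ne_zero.2 ht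
    have hla : l ≤ 𝓝 a := hl.trans nhdsWithin_le_nhds
    have hQO : (fun t => Q.eval t) =O[l] fun t => (t - a) ^ (k + 1) := by
      have hPO := (isBigO_refl (fun t => ((t - a) ^ n)⁻¹) l).mul hP
      refine hPO.congr' ?_ ?_
      · filter_upwards [hne] with t ht
        rw [hPQ]
        simp only [eval_mul, eval_pow, eval_sub, eval_X, eval_C]
        rw [inv_mul_cancel_left₀ (pow_ne_zero n ht)]
      · filter_upwards [hne] with t ht
        rw [add_assoc, pow_add, inv_mul_cancel_left₀ (pow_ne_zero n ht)]
    have hzero : Tendsto (fun t : 𝕜 => (t - a) ^ (k + 1)) l (𝓝 0) := by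
      have : ContinuousAt (fun t : 𝕜 => (t - a) ^ (k + 1)) a := by fun_prop
      simpa using this.mono_left hla
    exact hQ (dvd_iff_isRoot.2
      (tendsto_nhds_unique (Q.continuous.continuousAt.mono_left hla) (hQO.trans_tendsto hzero)))
  exact (le_rootMultiplicity_iff hP0).1 hle

theorem coeff_comp_neg_X {R : Type*} [CommRing R] (P : R[X]) (n : ℕ) :
    (P.comp (-X)).coeff n = (-1) ^ n * P.coeff n := by
  simpa [mul_comm] using comp_C_mul_X_coeff (p := P) (r := -1) (n := n)

theorem eq_of_even_coeff_eq_of_dvd {K : Type*} [Field K] {P Q : K[X]} {a : K} (ha : a ≠ -a) {N : ℕ}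
    (hP : P.natDegree < 2 * N) (hQ : Q.natDegree < 2 * N) (hPa : (X - C a) ^ N ∣ P)
    (hQa : (X - C a) ^ N ∣ Q) (heven : ∀ n, P.coeff (2 * n) = Q.coeff (2 * n)) : P = Q := by
  have hodd : (P - Q).comp (-X) = -(P - Q) := by
    ext n
    rw [coeff_comp_neg_X, coeff_neg]
    rcases n.even_or_odd' with ⟨k, rfl | rfl⟩
    · simp [heven]
    · simp [pow_succ]
  have hdvd : (X - C a) ^ N ∣ P - Q := dvd_sub hPa hQa
  have hdvd' : (X - C (-a)) ^ N ∣ P - Q := by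
    have hcomp : ((X - C a) ^ N).comp (-X) = (-1) ^ N * (X - C (-a)) ^ N := by
      rw [← mul_pow, pow_comp, sub_comp, X_comp, C_comp, C_neg]
      ring
    have hmap := map_dvd (compRingHom (-X)) hdvd
    rw [coe_compRingHom_apply, coe_compRingHom_apply, hcomp, hodd, dvd_neg] at hmap
    exact (Dvd.intro_left _ rfl).trans hmap
  have hcoprime : IsCoprime ((X - C a) ^ N) ((X - C (-a)) ^ N) :=
    (isCoprime_X_sub_C_of_isUnit_sub (sub_ne_zero.2 ha).isUnit).pow
  by_contra hne
  have hdeg := natDegree_le_of_dvd (hcoprime.mul_dvd hdvd hdvd') (sub_ne_zero.2 hne)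
  rw [((monic_X_sub_C a).pow N).natDegree_mul ((monic_X_sub_C (-a)).pow N)] at hdeg
  have := natDegree_sub_le P Q
  simp only [natDegree_pow, natDegree_X_sub_C, mul_one] at hdeg
  omega

theorem coeff_one_sub_X_pow {R : Type*} [CommRing R] (N n : ℕ) :
    ((1 - X : R[X]) ^ N).coeff n = (-1) ^ n * N.choose n := by
  rw [← coeff_one_add_X_pow, ← coeff_comp_neg_X]
  simp [sub_eq_add_neg]

end Polynomial

section Stieltjes

open Filter Topology

variable {α : Type*} [MeasurableSpace α] {μ : Measure α} {f g : α → ℝ}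

theorem integrable_mul_max_zero (hg : AEMeasurable g μ) (hfg : Integrable (fun x => f x * g x) μ) :
    Integrable (fun x => f x * max (g x) 0) μ := by
  refine (hfg.indicator₀ (nullMeasurableSet_lt (aemeasurable_const (b := 0)) hg)).congr
    (.of_forall fun x => ?_)
  by_cases hx : 0 < g x
  · simp [hx, hx.le]
  · simp [hx, not_lt.1 hx]

theorem integrable_withDensity_ofReal_iff (hg : AEMeasurable g μ) :
    Integrable f (μ.withDensity fun x => ENNReal.ofReal (g x)) ↔
      Integrable (fun x => f x * max (g x) 0) μ := by
  simp only [integrable_withDensity_iff_integrable_smul₀' hg.ennreal_ofReal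
    (.of_forall fun _ => ENNReal.ofReal_lt_top), ENNReal.toReal_ofReal', smul_eq_mul, mul_comm]

theorem integral_withDensity_ofReal (hg : AEMeasurable g μ) :
    ∫ x, f x ∂(μ.withDensity fun x => ENNReal.ofReal (g x)) = ∫ x, f x * max (g x) 0 ∂μ := by
  simp only [integral_withDensity_eq_integral_toReal_smul₀ hg.ennreal_ofReal
    (.of_forall fun _ => ENNReal.ofReal_lt_top), ENNReal.toReal_ofReal', smul_eq_mul, mul_comm]

theorem integral_toSignedMeasure [IsFiniteMeasure μ] :
    ∫ᵛ x, f x ∂•μ.toSignedMeasure = ∫ x, f x ∂μ := by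
  have hflip : (ContinuousLinearMap.lsmul ℝ ℝ : ℝ →L[ℝ] ℝ →L[ℝ] ℝ) =
      (ContinuousLinearMap.lsmul ℝ ℝ : ℝ →L[ℝ] ℝ →L[ℝ] ℝ).flip := by
    ext; simp
  rw [hflip, VectorMeasure.integral_toSignedMeasure]

theorem integrable_withDensityᵥ (hg : Integrable g μ) (hfg : Integrable (fun x => f x * g x) μ) :
    (μ.withDensityᵥ g).Integrable f := by
  have habs : (fun x => ‖g x‖ₑ) = fun x => ENNReal.ofReal |g x| :=
    funext fun x => Real.enorm_eq_ofReal_abs (g x)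
  rw [VectorMeasure.Integrable, Measure.variation_withDensityᵥ hg, habs,
    integrable_withDensity_ofReal_iff hg.aemeasurable.abs]
  have hneg : Integrable (fun x => f x * max (-g x) 0) μ :=
    integrable_mul_max_zero hg.aemeasurable.neg (by simpa using hfg.neg)
  refine ((integrable_mul_max_zero hg.aemeasurable hfg).add hneg).congr (.of_forall fun x => ?_)
  simp [← mul_add, max_zero_add_max_neg_zero_eq_abs_self]

theorem integral_withDensityᵥ (hg : Integrable g μ) (hfg : Integrable (fun x => f x * g x) μ) :
    ∫ᵛ x, f x ∂•(μ.withDensityᵥ g) = ∫ x, f x * g x ∂μ := by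
  have := isFiniteMeasure_withDensity_ofReal hg.2
  have hg' : Integrable (fun x => -g x) μ := hg.neg
  have := isFiniteMeasure_withDensity_ofReal hg'.2
  have hpos := integrable_mul_max_zero hg.aemeasurable hfg
  have hneg : Integrable (fun x => f x * max (-g x) 0) μ :=
    integrable_mul_max_zero hg'.aemeasurable (by simpa using hfg.neg)
  rw [withDensityᵥ_eq_withDensity_pos_part_sub_withDensity_neg_part hg,
    VectorMeasure.integral_sub_vectorMeasure, integral_toSignedMeasure, integral_toSignedMeasure,
    integral_withDensity_ofReal hg.aemeasurable, integral_withDensity_ofReal hg'.aemeasurable,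
    ← integral_sub hpos hneg]
  · simp only [← mul_sub, max_zero_sub_max_neg_zero_eq_self]
  · rwa [VectorMeasure.Integrable, Measure.variation_toSignedMeasure,
      integrable_withDensity_ofReal_iff hg.aemeasurable]
  · rwa [VectorMeasure.Integrable, Measure.variation_toSignedMeasure,
      integrable_withDensity_ofReal_iff hg'.aemeasurable]

/-- The function that agrees with `w` on `[a, b]`, is constant on `(-∞, a]` and vanishes beyond `b`,
where it jumps by `-w b`. -/
def cutoff (w : ℝ → ℝ) (a b r : ℝ) : ℝ :=
  if r ≤ b then w (max r a) else 0

variable {w : ℝ → ℝ} {a b : ℝ}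

theorem boundedVariationOn_cutoff (hw : ContDiff ℝ 1 w) (hab : a ≤ b) :
    BoundedVariationOn (cutoff w a b) univ := by
  obtain ⟨K, hK⟩ := hw.contDiffOn.exists_lipschitzOnWith one_ne_zero (convex_Icc a b) isCompact_Icc
  have hclamp : BoundedVariationOn (fun r => min (max r a) b) univ :=
    MonotoneOn.boundedVariationOn (C := max |a| |b|)
      (fun r _ s _ h => min_le_min_right _ (max_le_max_right _ h))
      fun r _ => abs_le_max_abs_abs (le_min (le_max_right _ _) hab) (min_le_right _ _)
  have hstep : BoundedVariationOn (fun r => if b < r then (1 : ℝ) else 0) univ :=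
    MonotoneOn.boundedVariationOn (C := 1)
      (fun r _ s _ h => by grind) fun r _ => by split_ifs <;> simp
  have hstep' : BoundedVariationOn (fun r => 1 - if b < r then (1 : ℝ) else 0) univ :=
    (IsometryEquiv.subLeft (1 : ℝ)).isometry.lipschitz.comp_boundedVariationOn hstep
  have hcomp : BoundedVariationOn (fun r => w (min (max r a) b)) univ :=
    hK.comp_boundedVariationOn (fun r _ => ⟨le_min (le_max_right _ _) hab, min_le_right _ _⟩) hclamp
  convert hcomp.mul hstep' using 1
  ext r
  rcases le_or_gt r b with h | h
  · simp [cutoff, h, h.not_gt, hab]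
  · simp [cutoff, h, h.not_ge]

theorem cutoff_of_lt {r : ℝ} (h : b < r) : cutoff w a b r = 0 := if_neg h.not_ge

theorem rightLim_cutoff (hw : Continuous w) (r : ℝ) :
    (cutoff w a b).rightLim r = if r < b then w (max r a) else 0 := by
  refine rightLim_eq_of_tendsto ?_
  split_ifs with h
  · have hc : ContinuousAt (fun r => w (max r a)) r := by fun_prop
    refine (hc.mono_left nhdsWithin_le_nhds).congr' ?_
    filter_upwards [Ioo_mem_nhdsGT h] with s hs
    exact (if_pos hs.2.le).symm
  · refine tendsto_const_nhds.congr' ?_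
    filter_upwards [self_mem_nhdsWithin] with s hs
    exact (cutoff_of_lt ((not_lt.1 h).trans_lt hs)).symm

theorem tendsto_cutoff_atTop : Tendsto (cutoff w a b) atTop (𝓝 0) :=
  tendsto_const_nhds.congr' ((eventually_gt_atTop b).mono fun _ h => (cutoff_of_lt h).symm)

theorem tendsto_cutoff_atBot : Tendsto (cutoff w a b) atBot (𝓝 (w a)) := by
  refine tendsto_const_nhds.congr' ?_
  filter_upwards [eventually_le_atBot a, eventually_le_atBot b] with r ha hb
  rw [cutoff, if_pos hb, max_eq_right ha]

theorem integral_deriv_eq_sub_of_contDiff (hw : ContDiff ℝ 1 w) (s t : ℝ) :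
    ∫ r in s..t, deriv w r = w t - w s :=
  intervalIntegral.integral_deriv_eq_sub
    (fun r _ => (hw.differentiable one_ne_zero) r)
    ((hw.continuous_deriv le_rfl).intervalIntegrable _ _)

theorem integrable_deriv_restrict_Ioc (hw : ContDiff ℝ 1 w) :
    Integrable (deriv w) (volume.restrict (Ioc a b)) :=
  (hw.continuous_deriv le_rfl).integrableOn_Ioc

theorem stieltjesMeasure_cutoff (hw : ContDiff ℝ 1 w) (hab : a ≤ b) :
    stieltjesMeasure (cutoff w a b) =
      (volume.restrict (Ioc a b)).withDensityᵥ (deriv w) + VectorMeasure.dirac b (-w b) := by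
  rw [stieltjesMeasure, dif_pos (boundedVariationOn_cutoff hw hab)]
  refine VectorMeasure.ext_of_generateFrom (range Ioi) ?_
    (BorelSpace.measurable_eq.trans (borel_eq_generateFrom_Ioi ℝ)) isPiSystem_Ioi ?_
  · rintro _ ⟨r, rfl⟩
    rw [BoundedVariationOn.vectorMeasure_Ioi, tendsto_cutoff_atTop.limUnder_eq,
      rightLim_cutoff hw.continuous, _root_.add_apply,
      withDensityᵥ_apply (integrable_deriv_restrict_Ioc hw) measurableSet_Ioi,
      Measure.restrict_restrict measurableSet_Ioi, inter_comm, Ioc_inter_Ioi, zero_sub, max_comm r]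
    split_ifs with h
    · rw [VectorMeasure.dirac_apply_of_mem measurableSet_Ioi h,
        ← intervalIntegral.integral_of_le (max_le hab h.le), integral_deriv_eq_sub_of_contDiff hw]
      ring
    · rw [VectorMeasure.dirac_apply_of_notMem (by simpa using h),
        Ioc_eq_empty fun hlt => h ((le_max_right _ _).trans_lt hlt)]
      simp
  · rw [BoundedVariationOn.vectorMeasure_univ, tendsto_cutoff_atTop.limUnder_eq,
      tendsto_cutoff_atBot.limUnder_eq, _root_.add_apply,
      withDensityᵥ_apply (integrable_deriv_restrict_Ioc hw) MeasurableSet.univ,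
      VectorMeasure.dirac_apply_of_mem MeasurableSet.univ (mem_univ _), Measure.restrict_univ,
      ← intervalIntegral.integral_of_le hab, integral_deriv_eq_sub_of_contDiff hw]
    ring

theorem integrable_mul_deriv_restrict_Ioc (hw : ContDiff ℝ 1 w) {f : ℝ → ℝ} {K : ℝ}
    (hf : Measurable f) (hK : ∀ r, |f r| ≤ K) :
    Integrable (fun r => f r * deriv w r) (volume.restrict (Ioc a b)) :=
  (integrable_deriv_restrict_Ioc hw).bdd_mul hf.aestronglyMeasurable (.of_forall hK)

theorem integrable_dirac_vectorMeasure {f : ℝ → ℝ} (c v : ℝ) :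
    (VectorMeasure.dirac c v).Integrable f := by
  rw [VectorMeasure.Integrable, VectorMeasure.variation_dirac]
  exact (integrable_dirac (by simp)).smul_measure (by simp)

theorem integrable_stieltjesMeasure_cutoff (hw : ContDiff ℝ 1 w) (hab : a ≤ b) {f : ℝ → ℝ} {K : ℝ}
    (hf : Measurable f) (hK : ∀ r, |f r| ≤ K) :
    (stieltjesMeasure (cutoff w a b)).Integrable f := by
  rw [stieltjesMeasure_cutoff hw hab]
  exact (integrable_withDensityᵥ (integrable_deriv_restrict_Ioc hw)
    (integrable_mul_deriv_restrict_Ioc hw hf hK)).add_vectorMeasure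
    (integrable_dirac_vectorMeasure b _)

theorem integral_stieltjesMeasure_cutoff (hw : ContDiff ℝ 1 w) (hab : a ≤ b) {f : ℝ → ℝ} {K : ℝ}
    (hf : Measurable f) (hK : ∀ r, |f r| ≤ K) :
    ∫ᵛ r, f r ∂•(stieltjesMeasure (cutoff w a b)) =
      (∫ r in Ioc a b, f r * deriv w r) - f b * w b := by
  have hderiv : Integrable (deriv w) (volume.restrict (Ioc a b)) := integrable_deriv_restrict_Ioc hw
  have hmul := integrable_mul_deriv_restrict_Ioc (a := a) (b := b) hw hf hK
  rw [stieltjesMeasure_cutoff hw hab, VectorMeasure.integral_add_vectorMeasure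
    (integrable_withDensityᵥ hderiv hmul) (integrable_dirac_vectorMeasure b _),
    integral_withDensityᵥ hderiv hmul, VectorMeasure.integral_dirac]
  simp [sub_eq_add_neg]

end Stieltjes

section Lens

open Metric
open scoped RealInnerProductSpace

/-- Up to a constant, the volume of the cap `{x | u < x₁}` of the unit ball of dimension `n + 1`:
the slice at `x₁ = s` is a ball of dimension `n` and radius `√(1 - s ^ 2)`. -/
def capIntegral (n : ℕ) (u : ℝ) : ℝ := ∫ s in Ioc u 1, √(1 - s ^ 2) ^ n

theorem integrableOn_sqrt_pow_Ioc (n : ℕ) (R a b : ℝ) :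
    IntegrableOn (fun s : ℝ => √(R ^ 2 - s ^ 2) ^ n) (Ioc a b) :=
  (by fun_prop : Continuous fun s : ℝ => √(R ^ 2 - s ^ 2) ^ n).integrableOn_Ioc

theorem capIntegral_nonneg (n : ℕ) (u : ℝ) : 0 ≤ capIntegral n u :=
  integral_nonneg fun _ => by positivity

theorem antitone_capIntegral (n : ℕ) : Antitone (capIntegral n) := fun u v huv =>
  setIntegral_mono_set (by simpa using integrableOn_sqrt_pow_Ioc n 1 u 1)
    (.of_forall fun _ => by positivity) (Ioc_subset_Ioc_left huv).eventuallyLE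

theorem capIntegral_zero_pos (n : ℕ) : 0 < capIntegral n 0 := by
  rw [capIntegral, ← intervalIntegral.integral_of_le zero_le_one]
  refine intervalIntegral.intervalIntegral_pos_of_pos_on
    ((by fun_prop : Continuous fun s : ℝ => √(1 - s ^ 2) ^ n).intervalIntegrable _ _)
    (fun s hs => ?_) one_pos
  have : 0 < 1 - s ^ 2 := by nlinarith [hs.1, hs.2]
  positivity

theorem setIntegral_Ioc_sqrt_pow (n : ℕ) (a : ℝ) {R : ℝ} (hR : 0 < R) :
    ∫ s in Ioc a R, √(R ^ 2 - s ^ 2) ^ n = R ^ (n + 1) * capIntegral n (a / R) := by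
  have hscale : ∀ s : ℝ, √(R ^ 2 - (R • s) ^ 2) ^ n = R ^ n * √(1 - s ^ 2) ^ n := fun s => by
    rw [← mul_pow, smul_eq_mul, show R ^ 2 - (R * s) ^ 2 = R ^ 2 * (1 - s ^ 2) by ring,
      Real.sqrt_mul (sq_nonneg R), Real.sqrt_sq hR.le]
  have hsubst := Measure.setIntegral_comp_smul_of_pos volume
    (fun s => √(R ^ 2 - s ^ 2) ^ n) (Ioc (a / R) 1) hR
  rw [LinearOrderedField.smul_Ioc hR, mul_div_cancel₀ _ hR.ne', mul_one, Module.finrank_self,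
    pow_one, smul_eq_mul] at hsubst
  simp only [hscale, integral_const_mul] at hsubst
  rw [capIntegral, pow_succ' R n, mul_assoc, hsubst, mul_inv_cancel_left₀ hR.ne']

variable {E : Type*} [NormedAddCommGroup E] [InnerProductSpace ℝ E]

theorem norm_smul_add_sq {v : E} (hv : ‖v‖ = 1) (s : ℝ) (w : (Submodule.span ℝ {v})ᗮ) :
    ‖s • v + (w : E)‖ ^ 2 = s ^ 2 + ‖w‖ ^ 2 := by
  have h : ⟪s • v, (w : E)⟫ = 0 := by
    rw [real_inner_smul_left, Submodule.mem_orthogonal_singleton_iff_inner_right.1 w.2, mul_zero]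
  have := norm_add_sq_eq_norm_sq_add_norm_sq_of_inner_eq_zero _ _ h
  rw [← sq, ← sq, ← sq, norm_smul, hv, mul_one, Real.norm_eq_abs, sq_abs] at this
  simpa using this

theorem exists_norm_eq_one_and_eq_norm_smul [Nontrivial E] (x : E) :
    ∃ v : E, ‖v‖ = 1 ∧ x = ‖x‖ • v := by
  rcases eq_or_ne x 0 with rfl | hx
  · obtain ⟨v, hv⟩ := exists_norm_eq E zero_le_one
    exact ⟨v, hv, by simp⟩
  · exact ⟨‖x‖⁻¹ • x, norm_smul_inv_norm hx, by
      rw [smul_inv_smul₀ (norm_ne_zero_iff.2 hx)]⟩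

theorem mem_closedBall_iff_of_orthogonal {v : E} (hv : ‖v‖ = 1) {R : ℝ} (hR : 0 ≤ R) (a s : ℝ)
    (w : (Submodule.span ℝ {v})ᗮ) :
    s • v + (w : E) ∈ closedBall (a • v) R ↔ (s - a) ^ 2 + ‖w‖ ^ 2 ≤ R ^ 2 := by
  rw [mem_closedBall_iff_norm, ← sq_le_sq₀ (norm_nonneg _) hR, ← norm_smul_add_sq hv, sub_smul,
    add_sub_right_comm]

theorem lens_slice {v : E} (hv : ‖v‖ = 1) {a R : ℝ} (ha : 0 ≤ a) (hR : 0 ≤ R) (s : ℝ) :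
    {w : (Submodule.span ℝ {v})ᗮ |
        s • v + (w : E) ∈ closedBall (a • v) R ∩ closedBall ((-a) • v) R} =
      if |s| ≤ R - a then closedBall 0 √(R ^ 2 - (|s| + a) ^ 2) else ∅ := by
  have hiff : ∀ w : (Submodule.span ℝ {v})ᗮ,
      s • v + (w : E) ∈ closedBall (a • v) R ∩ closedBall ((-a) • v) R ↔
        (|s| + a) ^ 2 + ‖w‖ ^ 2 ≤ R ^ 2 := by
    intro w
    rw [mem_inter_iff, mem_closedBall_iff_of_orthogonal hv hR,
      mem_closedBall_iff_of_orthogonal hv hR]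
    have hmax : (|s| + a) ^ 2 = max ((s - a) ^ 2) ((s - -a) ^ 2) := by
      rcases abs_cases s with ⟨h, h'⟩ | ⟨h, h'⟩ <;> rw [h]
      · rw [max_eq_right (by nlinarith)]; ring
      · rw [max_eq_left (by nlinarith)]; ring
    rw [hmax, ← max_add_add_right, max_le_iff]
  ext w
  rw [mem_ofPred_eq, hiff w]
  have hs := abs_nonneg s
  split_ifs with h
  · rw [mem_closedBall_zero_iff, Real.le_sqrt (norm_nonneg _) (by nlinarith)]
    constructor <;> intro <;> linarith
  · simp only [mem_empty_iff_false, iff_false, not_le]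
    nlinarith [sq_nonneg ‖w‖]

variable [FiniteDimensional ℝ E] [MeasurableSpace E] [BorelSpace E]

theorem measurePreserving_smul_add {v : E} (hv : ‖v‖ = 1) :
    MeasurePreserving (fun p : ℝ × (Submodule.span ℝ {v})ᗮ => p.1 • v + (p.2 : E)) := by
  have hline := (LinearIsometryEquiv.toSpanUnitSingleton (𝕜 := ℝ) v hv).measurePreserving
  have hprod := hline.prod (MeasurePreserving.id (volume : Measure (Submodule.span ℝ {v})ᗮ))
  exact (Submodule.span ℝ {v}).orthogonalDecomposition.symm.measurePreserving.comp
    ((WithLp.volume_preserving_toLp _ _).comp hprod)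

theorem volume_real_lens_slice {n : ℕ} (hE : Module.finrank ℝ E = n + 1) {v : E} (hv : ‖v‖ = 1)
    {a R : ℝ} (ha : 0 ≤ a) (hR : 0 ≤ R) (s : ℝ) :
    volume.real {w : (Submodule.span ℝ {v})ᗮ |
        s • v + (w : E) ∈ closedBall (a • v) R ∩ closedBall ((-a) • v) R} =
      (Iic (R - a)).indicator (fun s => √(R ^ 2 - (s + a) ^ 2) ^ n) |s| *
        volume.real (ball (0 : (Submodule.span ℝ {v})ᗮ) 1) := by
  have hfinrank : Module.finrank ℝ (Submodule.span ℝ {v})ᗮ = n := by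
    have : Fact (Module.finrank ℝ E = n + 1) := ⟨hE⟩
    exact Submodule.finrank_orthogonal_span_singleton (by rintro rfl; simp at hv)
  rw [lens_slice hv ha hR]
  split_ifs with h
  · rw [Measure.addHaar_real_closedBall _ _ (Real.sqrt_nonneg _), hfinrank,
      indicator_of_mem (mem_Iic.2 h)]
  · rw [measureReal_empty, indicator_of_notMem (by simpa using h), zero_mul]

theorem measureReal_prod_eq_integral {α β : Type*} [MeasurableSpace α] [MeasurableSpace β]
    {μ : Measure α} {ν : Measure β} [SFinite ν] {s : Set (α × β)} (hs : MeasurableSet s)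
    (hfin : ∀ x, ν (Prod.mk x ⁻¹' s) < ⊤) :
    (μ.prod ν).real s = ∫ x, ν.real (Prod.mk x ⁻¹' s) ∂μ := by
  rw [measureReal_def, Measure.prod_apply hs,
    ← integral_toReal (measurable_measure_prodMk_left hs).aemeasurable (.of_forall hfin)]
  rfl

theorem volume_real_lens_centered {n : ℕ} (hE : Module.finrank ℝ E = n + 1) {v : E} (hv : ‖v‖ = 1)
    {a R : ℝ} (ha : 0 ≤ a) (hR : 0 < R) :
    volume.real (closedBall (a • v) R ∩ closedBall ((-a) • v) R) =
      2 * R ^ (n + 1) * capIntegral n (a / R) *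
        volume.real (ball (0 : (Submodule.span ℝ {v})ᗮ) 1) := by
  have hlens : MeasurableSet (closedBall (a • v) R ∩ closedBall ((-a) • v) R) :=
    measurableSet_closedBall.inter measurableSet_closedBall
  have hcoord := measurePreserving_smul_add hv
  have hfin : ∀ s : ℝ, volume {w : (Submodule.span ℝ {v})ᗮ |
      s • v + (w : E) ∈ closedBall (a • v) R ∩ closedBall ((-a) • v) R} < ⊤ := fun s => by
    rw [lens_slice hv ha hR.le]
    split_ifs
    · exact measure_closedBall_lt_top
    · simp
  have hhalf : ∫ s in Ioi (0 : ℝ), (Iic (R - a)).indicator (fun s => √(R ^ 2 - (s + a) ^ 2) ^ n) s =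
      R ^ (n + 1) * capIntegral n (a / R) := by
    have hshift := (measurePreserving_add_right volume a).setIntegral_preimage_emb
      (measurableEmbedding_addRight a) (fun s => √(R ^ 2 - s ^ 2) ^ n) (Ioc a R)
    rw [preimage_add_const_Ioc, sub_self] at hshift
    rw [setIntegral_indicator measurableSet_Iic, Ioi_inter_Iic, hshift,
      setIntegral_Ioc_sqrt_pow n a hR]
  calc volume.real (closedBall (a • v) R ∩ closedBall ((-a) • v) R)
      = ∫ s : ℝ, volume.real {w : (Submodule.span ℝ {v})ᗮ |
          s • v + (w : E) ∈ closedBall (a • v) R ∩ closedBall ((-a) • v) R} := by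
        rw [← hcoord.measureReal_preimage hlens.nullMeasurableSet]
        exact measureReal_prod_eq_integral (hcoord.measurable hlens) hfin
    _ = 2 * R ^ (n + 1) * capIntegral n (a / R) *
        volume.real (ball (0 : (Submodule.span ℝ {v})ᗮ) 1) := by
        simp only [volume_real_lens_slice hE hv ha hR.le]
        rw [integral_mul_const, integral_comp_abs, hhalf]
        ring

theorem volume_real_lens_div_volume_real_closedBall {n : ℕ} (hE : Module.finrank ℝ E = n + 1)
    (x y : E) {R : ℝ} (hR : 0 < R) :
    volume.real (closedBall x R ∩ closedBall y R) / volume.real (closedBall (0 : E) R) =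
      capIntegral n (‖x - y‖ / (2 * R)) / capIntegral n 0 := by
  have : Nontrivial E := Module.nontrivial_of_finrank_pos (R := ℝ) (by omega)
  obtain ⟨v, hv, hxy⟩ := exists_norm_eq_one_and_eq_norm_smul (x - y)
  have htranslate : volume.real (closedBall x R ∩ closedBall y R) =
      volume.real (closedBall ((‖x - y‖ / 2) • v) R ∩ closedBall ((-(‖x - y‖ / 2)) • v) R) := by
    have hhalf : (‖x - y‖ / 2) • v = (2⁻¹ : ℝ) • (x - y) := by
      rw [div_eq_inv_mul, mul_smul, ← hxy]
    rw [← (measurePreserving_add_right volume ((2⁻¹ : ℝ) • (x + y))).measureReal_preimage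
        (measurableSet_closedBall.inter measurableSet_closedBall).nullMeasurableSet,
      preimage_inter, Metric.preimage_add_right_closedBall, Metric.preimage_add_right_closedBall,
      neg_smul, hhalf]
    congr 3 <;> module
  have hball := volume_real_lens_centered hE hv le_rfl hR
  rw [zero_smul, neg_zero, zero_smul, inter_self, zero_div] at hball
  have hω : 0 < volume.real (ball (0 : (Submodule.span ℝ {v})ᗮ) 1) :=
    ENNReal.toReal_pos (measure_ball_pos _ _ one_pos).ne' measure_ball_lt_top.ne
  rw [htranslate, volume_real_lens_centered hE hv (by positivity) hR, hball, div_div,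
    mul_div_mul_right _ _ hω.ne', mul_div_mul_left _ _ (by positivity)]

end Lens

section BallKernel

open Metric

theorem dirac_real_closedBall {X : Type*} [PseudoMetricSpace X] [MeasurableSpace X]
    [OpensMeasurableSpace X] (x z : X) (R : ℝ) :
    (Measure.dirac x).real (closedBall z R) = (closedBall x R).indicator 1 z := by
  rw [measureReal_def, Measure.dirac_apply' _ measurableSet_closedBall]
  by_cases h : x ∈ closedBall z R
  · simp [h, mem_closedBall_comm.1 h]
  · simp [h, mt mem_closedBall_comm.1 h]

theorem ballKernel_eq_volume_real_inter_div {d : ℕ} (r : ℝ) (x y : EuclideanSpace ℝ (Fin d)) :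
    ballKernel d r x y = volume.real (closedBall x (r / 2) ∩ closedBall y (r / 2)) /
      volume.real (closedBall (0 : EuclideanSpace ℝ (Fin d)) (r / 2)) := by
  rw [ballKernel, inv_mul_eq_div,
    ← integral_indicator_one (measurableSet_closedBall.inter measurableSet_closedBall)]
  simp only [dirac_real_closedBall, inter_indicator_one, Pi.mul_apply]

variable {n : ℕ} (x y : EuclideanSpace ℝ (Fin (n + 1)))

theorem ballKernel_of_pos {r : ℝ} (hr : 0 < r) :
    ballKernel (n + 1) r x y = capIntegral n (‖x - y‖ / r) / capIntegral n 0 := by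
  rw [ballKernel_eq_volume_real_inter_div,
    volume_real_lens_div_volume_real_closedBall finrank_euclideanSpace_fin x y (half_pos hr),
    mul_div_cancel₀ _ two_ne_zero]

theorem ballKernel_of_nonpos {r : ℝ} (hr : r ≤ 0) : ballKernel (n + 1) r x y = 0 := by
  have hball : volume.real (closedBall (0 : EuclideanSpace ℝ (Fin (n + 1))) (r / 2)) = 0 := by
    rw [measureReal_def, measure_mono_null (closedBall_subset_closedBall
      (by linarith : r / 2 ≤ 0)) (by simp), ENNReal.toReal_zero]
  rw [ballKernel_eq_volume_real_inter_div, hball, div_zero]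

theorem ballKernel_eq_indicator :
    (fun r => ballKernel (n + 1) r x y) =
      (Ioi 0).indicator fun r => capIntegral n (‖x - y‖ / r) / capIntegral n 0 := by
  ext r
  rcases lt_or_ge 0 r with hr | hr
  · rw [indicator_of_mem (mem_Ioi.2 hr), ballKernel_of_pos x y hr]
  · rw [indicator_of_notMem (by simpa using hr), ballKernel_of_nonpos x y hr]

theorem measurable_ballKernel : Measurable fun r => ballKernel (n + 1) r x y := by
  rw [ballKernel_eq_indicator]
  exact (((antitone_capIntegral n).measurable.comp
    (measurable_const.div measurable_id)).div_const _).indicator measurableSet_Ioi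

theorem abs_ballKernel_le_one (r : ℝ) : |ballKernel (n + 1) r x y| ≤ 1 := by
  rcases lt_or_ge 0 r with hr | hr
  · rw [ballKernel_of_pos x y hr,
      abs_of_nonneg (div_nonneg (capIntegral_nonneg n _) (capIntegral_nonneg n 0))]
    exact div_le_one_of_le₀ (antitone_capIntegral n (by positivity)) (capIntegral_nonneg n 0)
  · simp [ballKernel_of_nonpos x y hr]

end BallKernel

section Mixture

theorem setIntegral_Ioc_div_eq_indicator {a t x : ℝ} (f : ℝ → ℝ) (ht : 0 ≤ t) (hx : 0 < x) :
    ∫ s in Ioc (t / x) a, f s = ∫ s in Ioc 0 a, {s | t < s * x}.indicator f s := by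
  rw [setIntegral_indicator (measurableSet_lt measurable_const (by fun_prop))]
  congr 2
  ext s
  simp only [mem_inter_iff, mem_Ioc, mem_ofPred_eq, div_lt_iff₀ hx]
  exact ⟨fun h => ⟨⟨pos_of_mul_pos_left (ht.trans_lt h.1) hx.le, h.2⟩, h.1⟩,
    fun h => ⟨h.2, h.1.2⟩⟩

/-- Both sides integrate `ρ s * g r` over the part of the rectangle where `t < s * r`. -/
theorem setIntegral_setIntegral_Ioc_div_mul {ρ g : ℝ → ℝ} {a b t : ℝ}
    (hρ : IntegrableOn ρ (Ioc 0 a)) (hg : IntegrableOn g (Ioc 0 b)) (ht : 0 ≤ t) :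
    ∫ r in Ioc 0 b, (∫ s in Ioc (t / r) a, ρ s) * g r =
      ∫ s in Ioc 0 a, ρ s * ∫ r in Ioc (t / s) b, g r := by
  have hint : Integrable (Function.uncurry fun r s => {p : ℝ × ℝ | t < p.1 * p.2}.indicator
      (fun p => g p.1 * ρ p.2) (r, s))
      ((volume.restrict (Ioc 0 b)).prod (volume.restrict (Ioc 0 a))) :=
    (Integrable.mul_prod hg hρ).indicator (measurableSet_lt measurable_const (by fun_prop))
  have hswap := integral_integral_swap hint
  refine Eq.trans (setIntegral_congr_fun measurableSet_Ioc fun r hr => ?_) (hswap.trans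
    (setIntegral_congr_fun measurableSet_Ioc fun s hs => ?_))
  · rw [setIntegral_Ioc_div_eq_indicator ρ ht hr.1, mul_comm, ← integral_const_mul]
    congr 1 with s
    simp [indicator_apply, mul_comm]
  · rw [setIntegral_Ioc_div_eq_indicator g ht hs.1, ← integral_const_mul]
    congr 1 with r
    simp [indicator_apply, mul_comm]

variable {w : ℝ → ℝ} {b t : ℝ}

theorem integrableOn_comp_div_mul {ρ : ℝ → ℝ} {a : ℝ} (hρ : IntegrableOn ρ (Ioc 0 a))
    (hw : Continuous w) (hb : 0 < b) (ht : 0 ≤ t) :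
    IntegrableOn (fun s => w (t / s) * ρ s) (Ioc (t / b) a) := by
  obtain ⟨K, hK⟩ := isCompact_Icc.exists_bound_of_continuousOn (s := Icc 0 b) hw.continuousOn
  refine (hρ.mono_set (Ioc_subset_Ioc_left (by positivity))).bdd_mul
    (hw.measurable.comp (measurable_const.div measurable_id)).aestronglyMeasurable
    (ae_restrict_of_forall_mem measurableSet_Ioc fun s hs => hK (t / s) ?_)
  have hs0 : 0 < s := (by positivity : 0 ≤ t / b).trans_lt hs.1
  exact ⟨by positivity, ((div_lt_comm₀ hb hs0).1 hs.1).le⟩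

theorem setIntegral_setIntegral_Ioc_div_mul_deriv {ρ : ℝ → ℝ} {a : ℝ}
    (hρ : IntegrableOn ρ (Ioc 0 a)) (hw : ContDiff ℝ 1 w) (hb : 0 < b) (ht : 0 ≤ t) :
    ∫ r in Ioc 0 b, (∫ s in Ioc (t / r) a, ρ s) * deriv w r =
      w b * (∫ s in Ioc (t / b) a, ρ s) - ∫ s in Ioc (t / b) a, w (t / s) * ρ s := by
  have hsub : Ioc (t / b) a ⊆ Ioc 0 a := Ioc_subset_Ioc_left (by positivity)
  rw [setIntegral_setIntegral_Ioc_div_mul hρ (integrable_deriv_restrict_Ioc hw) ht,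
    ← integral_const_mul, ← integral_sub ((hρ.mono_set hsub).const_mul _)
      (integrableOn_comp_div_mul hρ hw.continuous hb ht),
    setIntegral_eq_of_subset_of_forall_sdiff_eq_zero measurableSet_Ioc hsub]
  · refine setIntegral_congr_fun measurableSet_Ioc fun s hs => ?_
    have hts : t / s ≤ b := ((div_lt_comm₀ hb (hsub hs).1).1 hs.1).le
    rw [← intervalIntegral.integral_of_le hts, integral_deriv_eq_sub_of_contDiff hw]
    ring
  · intro s hs
    have hbt : b ≤ t / s := by
      by_contra! h
      exact hs.2 ⟨(div_lt_comm₀ hs.1.1 hb).1 h, hs.1.2⟩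
    rw [Ioc_eq_empty hbt.not_gt, setIntegral_empty, mul_zero]

variable {n : ℕ} (x y : EuclideanSpace ℝ (Fin (n + 1)))

theorem integrable_ballKernel_stieltjesMeasure_cutoff (hw : ContDiff ℝ 1 w) (hb : 0 ≤ b) :
    (stieltjesMeasure (cutoff w 0 b)).Integrable fun r => ballKernel (n + 1) r x y :=
  integrable_stieltjesMeasure_cutoff hw hb (measurable_ballKernel x y) (abs_ballKernel_le_one x y)

theorem neg_integral_ballKernel_stieltjesMeasure_cutoff (hw : ContDiff ℝ 1 w) (hb : 0 < b) :
    -∫ᵛ r in Ioi 0, ballKernel (n + 1) r x y ∂•(stieltjesMeasure (cutoff w 0 b)) =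
      (∫ s in Ioc (‖x - y‖ / b) 1, w (‖x - y‖ / s) * √(1 - s ^ 2) ^ n) / capIntegral n 0 := by
  have hρ : IntegrableOn (fun s : ℝ => √(1 - s ^ 2) ^ n) (Ioc 0 1) := by
    simpa using integrableOn_sqrt_pow_Ioc n 1 0 1
  have hparts : ∫ r in Ioc 0 b, ballKernel (n + 1) r x y * deriv w r =
      (∫ r in Ioc 0 b, capIntegral n (‖x - y‖ / r) * deriv w r) / capIntegral n 0 := by
    rw [← integral_div]
    refine setIntegral_congr_fun measurableSet_Ioc fun r hr => ?_
    beta_reduce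
    rw [ballKernel_of_pos x y hr.1, div_mul_eq_mul_div]
  rw [VectorMeasure.setIntegral_eq_integral_of_forall_compl_eq_zero measurableSet_Ioi
      fun r hr => ballKernel_of_nonpos x y (not_lt.1 hr),
    integral_stieltjesMeasure_cutoff hw hb.le (measurable_ballKernel x y)
      (abs_ballKernel_le_one x y), hparts, ballKernel_of_pos x y hb]
  simp only [capIntegral]
  rw [setIntegral_setIntegral_Ioc_div_mul_deriv hρ hw hb (norm_nonneg _)]
  ring

end Mixture

section Hypergeometric

open Polynomial
open scoped Nat

theorem cast_choose_succ_mul {R : Type*} [CommRing R] (N k : ℕ) :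
    (N.choose (k + 1) : R) * (k + 1) = N.choose k * (N - k) := by
  rcases le_or_gt k N with h | h
  · simpa [Nat.cast_sub h] using congrArg (Nat.cast : ℕ → R) (Nat.choose_succ_right_eq N k)
  · simp [Nat.choose_eq_zero_of_lt h, Nat.choose_eq_zero_of_lt (h.trans k.lt_succ_self)]

variable {𝕜 : Type*} [Field 𝕜]

theorem ascPochhammer_eval_neg_half_mul [CharZero 𝕜] (N n : ℕ) :
    (ascPochhammer 𝕜 n).eval (-N / 2 : 𝕜) * (ascPochhammer 𝕜 n).eval ((1 - N) / 2 : 𝕜) =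
      n ! * N.choose (2 * n) * (ascPochhammer 𝕜 n).eval (1 / 2 : 𝕜) := by
  induction n with
  | zero => simp
  | succ n ih =>
    have hodd := cast_choose_succ_mul (R := 𝕜) N (2 * n)
    have heven := cast_choose_succ_mul (R := 𝕜) N (2 * n + 1)
    simp only [ascPochhammer_succ_eval, Nat.factorial_succ, mul_add_one 2 n]
    push_cast at hodd heven ⊢
    linear_combination (-N / 2 + n) * ((1 - N) / 2 + n) * ih -
      n ! * (ascPochhammer 𝕜 n).eval (1 / 2 : 𝕜) *
        ((2 * n + 1) / 4 * heven + (N - 2 * n - 1) / 4 * hodd)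

theorem ordinaryHypergeometricCoefficient_neg_half [CharZero 𝕜] (N : ℕ) (c : 𝕜) (n : ℕ) :
    ordinaryHypergeometricCoefficient (-N / 2 : 𝕜) ((1 - N) / 2) c n =
      N.choose (2 * n) * ((ascPochhammer 𝕜 n).eval (1 / 2) / (ascPochhammer 𝕜 n).eval c) := by
  have hn : (n ! : 𝕜) ≠ 0 := mod_cast n.factorial_ne_zero
  rw [ordinaryHypergeometricCoefficient, mul_assoc _ (eval _ _) (eval _ _),
    ascPochhammer_eval_neg_half_mul]
  field_simp

/-- The polynomial `₂F₁ (-N / 2) ((1 - N) / 2) c`: one of the first two parameters is a nonpositive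
integer, so the series stops at degree `N / 2`. -/
def hypergeometricPoly (N : ℕ) (c : 𝕜) : 𝕜[X] :=
  ∑ n ∈ Finset.range (N / 2 + 1),
    monomial n (ordinaryHypergeometricCoefficient (-N / 2 : 𝕜) ((1 - N) / 2) c n)

theorem coeff_hypergeometricPoly [CharZero 𝕜] (N : ℕ) (c : 𝕜) (n : ℕ) :
    (hypergeometricPoly N c).coeff n =
      ordinaryHypergeometricCoefficient (-N / 2 : 𝕜) ((1 - N) / 2) c n := by
  simp only [hypergeometricPoly, finsetSum_coeff, coeff_monomial, Finset.sum_ite_eq',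
    Finset.mem_range, ite_eq_left_iff]
  intro hn
  rw [ordinaryHypergeometricCoefficient_neg_half, Nat.choose_eq_zero_of_lt (by omega),
    Nat.cast_zero, zero_mul]

theorem natDegree_hypergeometricPoly_le (N : ℕ) (c : 𝕜) :
    (hypergeometricPoly N c).natDegree ≤ N / 2 :=
  natDegree_sum_le_of_forall_le _ _ fun _ hn =>
    (natDegree_monomial_le _).trans (Nat.lt_succ_iff.1 (Finset.mem_range.1 hn))

theorem eval_hypergeometricPoly (N : ℕ) (c x : ℝ) :
    (hypergeometricPoly N c).eval x = ₂F₁ (-N / 2 : ℝ) ((1 - N) / 2) c x := by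
  rw [ordinaryHypergeometric_eq_tsum]
  beta_reduce
  rw [tsum_eq_sum (s := (hypergeometricPoly N c).support), eval_eq_sum, Polynomial.sum]
  · simp only [coeff_hypergeometricPoly, ordinaryHypergeometricCoefficient, smul_eq_mul]
  · intro n hn
    rw [notMem_support_iff, coeff_hypergeometricPoly, ordinaryHypergeometricCoefficient] at hn
    rw [hn, zero_smul]

theorem G_eq_cutoff (m : ℕ) :
    G (2 * m + 1) = cutoff
      (fun r => (hypergeometricPoly (m + 1) (-(2 * m + 1) / 2 : ℝ)).eval (r ^ 2)) 0 1 := by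
  have ha : -(((2 * m + 1 : ℕ) : ℝ) + 1) / 4 = -(m + 1 : ℕ) / 2 := by push_cast; ring
  have hb : -(((2 * m + 1 : ℕ) : ℝ) - 1) / 4 = (1 - (m + 1 : ℕ)) / 2 := by push_cast; ring
  ext r
  rw [G, cutoff, eval_hypergeometricPoly, ha, hb]
  push_cast
  rfl

end Hypergeometric

section Moment

open Polynomial

/-- The rational function `x ↦ ∫₀¹ s ^ (x - 1) * (1 - s ^ 2) ^ m ds`, expanded in partial fractions.
It continues the moments of `(1 - s ^ 2) ^ m` to negative exponents, where the integral diverges. -/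
def moment {𝕜 : Type*} [Field 𝕜] (m : ℕ) (x : 𝕜) : 𝕜 :=
  ∑ k ∈ Finset.range (m + 1), (-1) ^ k * m.choose k / (x + 2 * k)

theorem mul_moment_eq_mul_moment_add_two {𝕜 : Type*} [Field 𝕜] (m : ℕ) {x : 𝕜}
    (hx : ∀ k : ℕ, x + 2 * k ≠ 0) : x * moment m x = (x + 2 * m + 2) * moment m (x + 2) := by
  have hx' : ∀ k : ℕ, x + 2 + 2 * k ≠ 0 := fun k => by
    convert hx (k + 1) using 1
    push_cast
    ring
  have hleft : x * moment m x = ∑ k ∈ Finset.range (m + 1), (-1) ^ k * (m.choose k : 𝕜) -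
      ∑ k ∈ Finset.range (m + 1), (-1) ^ k * (m.choose k * (2 * k)) / (x + 2 * k) := by
    rw [moment, Finset.mul_sum, ← Finset.sum_sub_distrib]
    refine Finset.sum_congr rfl fun k _ => ?_
    field_simp [hx k]
    ring
  have hright : (x + 2 * m + 2) * moment m (x + 2) =
      ∑ k ∈ Finset.range (m + 1), (-1) ^ k * (m.choose k : 𝕜) +
      ∑ k ∈ Finset.range (m + 1), (-1) ^ k * (m.choose k * (2 * (m - k))) / (x + 2 + 2 * k) := by
    rw [moment, Finset.mul_sum, ← Finset.sum_add_distrib]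
    refine Finset.sum_congr rfl fun k _ => ?_
    field_simp [hx' k]
    ring
  rw [hleft, hright, Finset.sum_range_succ' (fun k : ℕ => _ / (x + 2 * k)),
    Finset.sum_range_succ (fun k : ℕ => _ / (x + 2 + 2 * k)), sub_eq_add_neg]
  simp only [Nat.cast_zero, sub_self, mul_zero, zero_div, add_zero, ← Finset.sum_neg_distrib]
  congr 1
  refine Finset.sum_congr rfl fun k _ => ?_
  rw [mul_left_comm _ 2 (_ - _), ← cast_choose_succ_mul, ← neg_div]
  push_cast
  ring_nf

theorem one_sub_two_mul_add_ne_zero (n k : ℕ) : (1 - 2 * n + 2 * k : ℝ) ≠ 0 := by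
  have : (1 - 2 * n + 2 * k : ℤ) ≠ 0 := by omega
  exact mod_cast this

theorem moment_one_sub_two_mul (m n : ℕ) :
    moment m (1 - 2 * n : ℝ) * (ascPochhammer ℝ n).eval (1 / 2) =
      moment m (1 : ℝ) * (ascPochhammer ℝ n).eval (-(2 * m + 1) / 2 : ℝ) := by
  induction n with
  | zero => simp
  | succ n ih =>
    have hrec := mul_moment_eq_mul_moment_add_two m (one_sub_two_mul_add_ne_zero (n + 1))
    rw [show (1 - 2 * (n + 1 : ℕ) + 2 : ℝ) = 1 - 2 * n by push_cast; ring] at hrec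
    simp only [ascPochhammer_succ_eval]
    push_cast at hrec ⊢
    linear_combination (-(2 * m + 1) / 2 + n) * ih -
      (ascPochhammer ℝ n).eval (1 / 2) / 2 * hrec

theorem coeff_hypergeometricPoly_mul_moment (m n : ℕ) :
    (hypergeometricPoly (m + 1) (-(2 * m + 1) / 2 : ℝ)).coeff n * moment m (1 - 2 * n : ℝ) =
      moment m 1 * (m + 1).choose (2 * n) := by
  have hc : (ascPochhammer ℝ n).eval (-(2 * m + 1) / 2 : ℝ) ≠ 0 := fun h => by
    obtain ⟨k, -, hk⟩ := (ascPochhammer_eval_eq_zero_iff _ _).1 h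
    exact one_sub_two_mul_add_ne_zero k m (by linarith)
  rw [coeff_hypergeometricPoly, ordinaryHypergeometricCoefficient_neg_half, mul_assoc,
    div_mul_eq_mul_div, mul_comm (eval _ _), moment_one_sub_two_mul, mul_div_cancel_right₀ _ hc,
    mul_comm]

end Moment

section Transform

open Polynomial Asymptotics Topology

/-- The polynomial in `t` that equals `∫ s in t..1, (t / s) ^ (2 * n) * (1 - s ^ 2) ^ m` for
`0 < t ≤ 1`. -/
def powTransform (m n : ℕ) : ℝ[X] :=
  ∑ k ∈ Finset.range (m + 1),
    C ((-1) ^ k * m.choose k / (1 - 2 * n + 2 * k) : ℝ) * (X ^ (2 * n) - X ^ (2 * k + 1))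

theorem coeff_two_mul_powTransform (m n j : ℕ) :
    (powTransform m n).coeff (2 * j) = if j = n then moment m (1 - 2 * n : ℝ) else 0 := by
  have hk : ∀ k : ℕ, 2 * j ≠ 2 * k + 1 := by omega
  simp [powTransform, moment, coeff_X_pow, hk]

theorem natDegree_powTransform_le {m n : ℕ} (hn : n ≤ m) :
    (powTransform m n).natDegree ≤ 2 * m + 1 := by
  refine natDegree_sum_le_of_forall_le _ _ fun k hk => (natDegree_C_mul_le _ _).trans ?_
  have hkm := Nat.lt_succ_iff.1 (Finset.mem_range.1 hk)
  refine (natDegree_sub_le _ _).trans (max_le ?_ ?_) <;> rw [natDegree_X_pow] <;> omega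

theorem div_pow_mul_one_sub_sq_pow_eq_sum (m n : ℕ) (t : ℝ) {s : ℝ} (hs : s ≠ 0) :
    (t / s) ^ (2 * n) * (1 - s ^ 2) ^ m = ∑ k ∈ Finset.range (m + 1),
      (-1) ^ k * m.choose k * t ^ (2 * n) * s ^ (2 * k - 2 * n : ℤ) := by
  rw [sub_eq_neg_add, add_pow, Finset.mul_sum]
  refine Finset.sum_congr rfl fun k _ => ?_
  have hzpow : s ^ (2 * k - 2 * n : ℤ) = s ^ (2 * k) / s ^ (2 * n) := by
    rw [zpow_sub₀ hs]
    norm_cast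
  rw [hzpow, neg_pow, one_pow, ← pow_mul, div_pow]
  ring

theorem integral_Ioc_div_pow_mul_one_sub_sq_pow (m : ℕ) {n : ℕ} {t : ℝ} (ht0 : 0 ≤ t) (ht1 : t ≤ 1)
    (h : n = 0 ∨ 0 < t) :
    ∫ s in Ioc t 1, (t / s) ^ (2 * n) * (1 - s ^ 2) ^ m = (powTransform m n).eval t := by
  have hexp : ∀ k : ℕ, (0 : ℤ) ≤ 2 * k - 2 * n ∨ (0 : ℝ) ∉ uIcc t 1 := fun k => by
    rcases h with rfl | h
    · exact .inl (by omega)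
    · exact .inr fun hmem => (h.trans_le (uIcc_of_le ht1 ▸ hmem).1).false
  have hterm : ∀ k : ℕ, ∫ s in t..1, s ^ (2 * k - 2 * n : ℤ) =
      (1 - t ^ (2 * k - 2 * n + 1 : ℤ)) / (1 - 2 * n + 2 * k) := fun k => by
    rw [integral_zpow ((hexp k).imp_right fun h0 => ⟨by omega, h0⟩), one_zpow]
    push_cast
    ring_nf
  have hmul : ∀ k : ℕ, t ^ (2 * n) * t ^ (2 * k - 2 * n + 1 : ℤ) = t ^ (2 * k + 1) := fun k => by
    rw [← zpow_natCast, ← zpow_natCast, ← zpow_add' (.inr (.inl (by omega)))]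
    congr 1
    push_cast
    ring
  rw [setIntegral_congr_fun measurableSet_Ioc fun s hs =>
      div_pow_mul_one_sub_sq_pow_eq_sum m n t (ht0.trans_lt hs.1).ne',
    ← intervalIntegral.integral_of_le ht1, intervalIntegral.integral_finsetSum fun k _ =>
      (intervalIntegral.intervalIntegrable_zpow (hexp k)).const_mul _, powTransform, eval_finsetSum]
  refine Finset.sum_congr rfl fun k _ => ?_
  rw [intervalIntegral.integral_const_mul, hterm, eval_mul, eval_C, eval_sub, eval_pow, eval_pow,
    eval_X, ← hmul]
  ring

theorem sqrt_one_sub_sq_pow_two_mul (m : ℕ) {s : ℝ} (hs : |s| ≤ 1) :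
    √(1 - s ^ 2) ^ (2 * m) = (1 - s ^ 2) ^ m := by
  rw [pow_mul, Real.sq_sqrt (sub_nonneg.2 ((sq_le_one_iff_abs_le_one s).2 hs))]

theorem capIntegral_two_mul {u : ℝ} (m : ℕ) (hu : -1 ≤ u) :
    capIntegral (2 * m) u = ∫ s in Ioc u 1, (1 - s ^ 2) ^ m :=
  setIntegral_congr_fun measurableSet_Ioc fun _ hs =>
    sqrt_one_sub_sq_pow_two_mul m (abs_le.2 ⟨hu.trans hs.1.le, hs.2⟩)

theorem moment_one_eq_capIntegral (m : ℕ) : moment m 1 = capIntegral (2 * m) 0 := by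
  have hint := integral_Ioc_div_pow_mul_one_sub_sq_pow m le_rfl zero_le_one (.inl rfl)
  simp only [mul_zero, pow_zero, one_mul] at hint
  rw [capIntegral_two_mul m (by norm_num), hint, ← coeff_zero_eq_eval_zero]
  simpa using (coeff_two_mul_powTransform m 0 0).symm

/-- The polynomial in `t` that equals `∫ s in t..1, P ((t / s) ^ 2) * (1 - s ^ 2) ^ m` for
`0 < t ≤ 1`. -/
def polyTransform (m : ℕ) (P : ℝ[X]) : ℝ[X] :=
  P.sum fun n c => C c * powTransform m n

theorem coeff_two_mul_polyTransform (m : ℕ) (P : ℝ[X]) (j : ℕ) :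
    (polyTransform m P).coeff (2 * j) = P.coeff j * moment m (1 - 2 * j : ℝ) := by
  simp only [polyTransform, Polynomial.sum, finsetSum_coeff, coeff_C_mul,
    coeff_two_mul_powTransform, mul_ite, mul_zero, Finset.sum_ite_eq, mem_support_iff]
  split_ifs with h
  · rfl
  · rw [not_not.1 h, zero_mul]

theorem natDegree_polyTransform_le {m : ℕ} {P : ℝ[X]} (hP : P.natDegree ≤ m) :
    (polyTransform m P).natDegree ≤ 2 * m + 1 :=
  natDegree_sum_le_of_forall_le _ _ fun n hn => (natDegree_C_mul_le _ _).trans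
    (natDegree_powTransform_le ((le_natDegree_of_mem_supp n hn).trans hP))

theorem integral_Ioc_eval_div_sq_mul_one_sub_sq_pow (m : ℕ) (P : ℝ[X]) {t : ℝ} (ht0 : 0 < t)
    (ht1 : t ≤ 1) :
    ∫ s in Ioc t 1, P.eval ((t / s) ^ 2) * (1 - s ^ 2) ^ m = (polyTransform m P).eval t := by
  have hρ : IntegrableOn (fun s : ℝ => (1 - s ^ 2) ^ m) (Ioc 0 1) :=
    (by fun_prop : Continuous fun s : ℝ => (1 - s ^ 2) ^ m).integrableOn_Ioc
  have hint : ∀ n : ℕ, IntegrableOn (fun s => (t / s) ^ (2 * n) * (1 - s ^ 2) ^ m) (Ioc t 1) :=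
    fun n => by simpa using integrableOn_comp_div_mul hρ (continuous_pow (2 * n)) one_pos ht0.le
  rw [polyTransform, Polynomial.sum, eval_finsetSum]
  simp only [eval_eq_sum (p := P), Polynomial.sum, Finset.sum_mul, eval_mul, eval_C, mul_assoc,
    ← pow_mul]
  rw [integral_finsetSum _ fun n _ => (hint n).const_mul _]
  simp only [integral_const_mul,
    integral_Ioc_div_pow_mul_one_sub_sq_pow m ht0.le ht1 (.inr ht0)]

theorem isBigO_integral_Ioc_comp_div_mul_one_sub_sq_pow {w : ℝ → ℝ} (m : ℕ) (hw : Continuous w) :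
    (fun t => ∫ s in Ioc t 1, w (t / s) * (1 - s ^ 2) ^ m) =O[𝓝[<] 1]
      fun t => (t - 1) ^ (m + 1) := by
  obtain ⟨K, hK⟩ := isCompact_Icc.exists_bound_of_continuousOn (s := Icc 0 1) hw.continuousOn
  refine IsBigO.of_bound (K * 2 ^ m) ?_
  filter_upwards [Ioo_mem_nhdsLT one_pos] with t ht
  have hbound : ∀ s ∈ Ioc t 1, ‖w (t / s) * (1 - s ^ 2) ^ m‖ ≤ K * (2 * (1 - t)) ^ m := by
    intro s hs
    have hs0 : 0 < s := ht.1.trans hs.1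
    have hsq : 0 ≤ 1 - s ^ 2 := by nlinarith [hs.2]
    have hle : 1 - s ^ 2 ≤ 2 * (1 - t) := by nlinarith [hs.1, hs.2]
    have hwK := hK (t / s) ⟨by positivity [ht.1], (div_le_one hs0).2 hs.1.le⟩
    rw [norm_mul, norm_pow, Real.norm_of_nonneg hsq]
    exact mul_le_mul hwK (pow_le_pow_left₀ hsq hle m) (by positivity) ((norm_nonneg _).trans hwK)
  refine (norm_setIntegral_le_of_norm_le_const measure_Ioc_lt_top hbound).trans_eq ?_
  have ht1 : 0 ≤ 1 - t := sub_nonneg.2 ht.2.le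
  rw [Real.volume_real_Ioc_of_le ht.2.le, norm_pow, norm_sub_rev, Real.norm_of_nonneg ht1, mul_pow]
  ring

theorem X_sub_C_one_pow_dvd_polyTransform (m : ℕ) (P : ℝ[X]) :
    (X - C 1) ^ (m + 1) ∣ polyTransform m P := by
  refine X_sub_C_pow_dvd_of_isBigO (nhdsLT_le_nhdsNE 1)
    ((isBigO_integral_Ioc_comp_div_mul_one_sub_sq_pow (w := fun r => P.eval (r ^ 2)) m
      (by fun_prop)).congr' ?_ .rfl)
  filter_upwards [Ioo_mem_nhdsLT one_pos] with t ht
  exact integral_Ioc_eval_div_sq_mul_one_sub_sq_pow m P ht.1 ht.2.le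

/-- The weight of the ball kernels is chosen so that its transform has the even coefficients of
`(1 - X) ^ (m + 1)`; the order of vanishing at `1` then determines the odd ones. -/
theorem polyTransform_hypergeometricPoly (m : ℕ) :
    polyTransform m (hypergeometricPoly (m + 1) (-(2 * m + 1) / 2)) =
      C (moment m 1) * (1 - X) ^ (m + 1) := by
  have hdeg : (hypergeometricPoly (m + 1) (-(2 * m + 1) / 2 : ℝ)).natDegree ≤ m :=
    (natDegree_hypergeometricPoly_le _ _).trans (by omega)
  refine eq_of_even_coeff_eq_of_dvd (a := 1) (N := m + 1) (by norm_num) ?_ ?_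
    (X_sub_C_one_pow_dvd_polyTransform m _)
    (dvd_mul_of_dvd_right (pow_dvd_pow_of_dvd ⟨-1, by simp⟩ _) _) fun n => ?_
  · have := natDegree_polyTransform_le hdeg
    omega
  · have : (1 - X : ℝ[X]).natDegree ≤ 1 := by compute_degree
    have := (natDegree_C_mul_le (moment m 1) ((1 - X : ℝ[X]) ^ (m + 1))).trans
      (natDegree_pow_le_of_le (m + 1) this)
    omega
  · rw [coeff_two_mul_polyTransform, coeff_hypergeometricPoly_mul_moment, coeff_C_mul,
      coeff_one_sub_X_pow, pow_mul, neg_one_sq, one_pow, one_mul]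

theorem integral_Ioc_hypergeometricPoly_mul_sqrt_pow (m : ℕ) {t : ℝ} (ht : 0 ≤ t) :
    ∫ s in Ioc t 1, (hypergeometricPoly (m + 1) (-(2 * m + 1) / 2 : ℝ)).eval ((t / s) ^ 2) *
      √(1 - s ^ 2) ^ (2 * m) = capIntegral (2 * m) 0 * (max (1 - t) 0) ^ (m + 1) := by
  rcases ht.eq_or_lt with rfl | ht
  · simp [capIntegral, eval_hypergeometricPoly]
  rcases le_total t 1 with ht1 | ht1
  · rw [max_eq_left (sub_nonneg.2 ht1), ← moment_one_eq_capIntegral]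
    rw [setIntegral_congr_fun measurableSet_Ioc fun s hs => congrArg (_ * ·)
        (sqrt_one_sub_sq_pow_two_mul m (abs_le.2 ⟨by linarith [hs.1], hs.2⟩)),
      integral_Ioc_eval_div_sq_mul_one_sub_sq_pow m _ ht ht1, polyTransform_hypergeometricPoly]
    simp
  · rw [max_eq_right (sub_nonpos.2 ht1), Ioc_eq_empty ht1.not_gt]
    simp

end Transform

end AskeyKernel

end

theorem mainTheorem6 (d : ℕ) (hd : Odd d) :
    BoundedVariationOn (AskeyKernel.G d) Set.univ ∧
    ∀ x y : EuclideanSpace ℝ (Fin d),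
      (AskeyKernel.stieltjesMeasure (AskeyKernel.G d)).IntegrableOn
        (fun r => AskeyKernel.ballKernel d r x y) (Set.Ioi 0) ∧
      AskeyKernel.kernel d x y = (max (1 - ‖x - y‖) 0) ^ ((d + 1) / 2) := by
  obtain ⟨m, rfl⟩ := hd
  have hw : ContDiff ℝ 1 fun r : ℝ =>
      (AskeyKernel.hypergeometricPoly (m + 1) (-(2 * m + 1) / 2 : ℝ)).eval (r ^ 2) :=
    (Polynomial.contDiff_aeval _ 1).comp (contDiff_id.pow 2)
  rw [AskeyKernel.G_eq_cutoff]
  refine ⟨AskeyKernel.boundedVariationOn_cutoff hw zero_le_one, fun x y => ⟨?_, ?_⟩⟩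
  · exact (AskeyKernel.integrable_ballKernel_stieltjesMeasure_cutoff x y hw
      zero_le_one).integrableOn
  · rw [AskeyKernel.kernel, AskeyKernel.G_eq_cutoff,
      AskeyKernel.neg_integral_ballKernel_stieltjesMeasure_cutoff x y hw one_pos, div_one,
      AskeyKernel.integral_Ioc_hypergeometricPoly_mul_sqrt_pow m (norm_nonneg _),
      mul_div_cancel_left₀ _ (AskeyKernel.capIntegral_zero_pos _).ne',
      show (2 * m + 1 + 1) / 2 = m + 1 by omega]
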